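/- Consider a binary linear code of length $n$ given by a parity-check matrix over $\mathbb F_2$ with $m$ rows, and its Tanner graph: the bipartite graph whose variable nodes $1,\dots,n$ are the columns, whose check nodes $a=1,\dots,m$ are the rows, with an edge between $i$ and $a$ when the entry $(a,i)$ is nonzero. Let $d_l$ and $d_r$ be the maximal variable-node and check-node degrees, $k=(d_l d_r)^{1/2}$, and let $\mathrm{dist}(i,j)$ be the smallest number of edges on a path of the Tanner graph connecting the variable nodes $i$ and $j$ ($+\infty$ if there is none). Bits are transmitted over a binary-input additive white Gaussian noise channel, bit $i$ with noise variance $\epsilon_i^2$, the all-zero codeword being sent, so that the half-log-likelihood ratios $l_1,\dots,l_n$ are independent and $l_i$ is Gaussian with mean and variance $\epsilon_i^{-2}$. In spin variables $\sigma_i=(-1)^{x_i}\in\{\pm1\}$, let $\langle\cdot\rangle_P$ be the average with respect to the posterior measure, which is proportional to $$\prod_{i=1}^n e^{l_i\sigma_i}\prod_{a=1}^m\tfrac12\Bigl(1+\prod_{i\in a}\sigma_i\Bigr),\qquad \sigma\in\{\pm1\}^n$$ (a perfectly received bit, $\epsilon_i=0$, $l_i=+\infty$, has $\sigma_i=1$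 fixed), where $i\in a$ means that $i$ is adjacent to $a$. Put $$C_P(i,j)=\mathbb E_{l}\bigl[\,|\langle\sigma_i\sigma_j\rangle_P-\langle\sigma_i\rangle_P\langle\sigma_j\rangle_P|\,\bigr].$$ **Theorem.** There are strictly positive purely numerical constants $\epsilon_0,c_1,c_2,c$ such that for every such code, every $\epsilon>0$ with $\epsilon^2\,k^2\ln k\le\epsilon_0^2$ (that is, $\epsilon^2\le\epsilon_0^2k^{-2}(\ln k)^{-1}$; no condition on $\epsilon$ when $k\in\{0,1\}$), and all bits $i,j$ with $\mathrm{dist}(i,j)>4d_l$, the following hold. 1. If $\epsilon_v=\epsilon$ for all $v$, then $$C_P(i,j)\le c_1\,e^{-\frac{c_2}{\epsilon^2k}\mathrm{dist}(i,j)}.$$ 2. More generally, if $0\le\epsilon_v\le\epsilon$ for all $v$, then $$C_P(i,j)\le c_1\,e^{-c\left(\frac1{\epsilon_i^2}+\frac1{\epsilon_j^2}\right)}\,e^{-\frac{c_2}{\epsilon^2k}\mathrm{dist}(i,j)}.$$ Here an exponential whose exponent is $-\infty$, because $\mathrm{dist}(i,j)=\infty$, $\epsilon_i=0$ or $\epsilon_j=0$,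 is read as $0$. -/

import Mathlib

open MeasureTheory ProbabilityTheory

namespace LDPC

/-! A binary linear code of block length `n` is given by a parity-check matrix
`H : Matrix (Fin m) (Fin n) (ZMod 2)`: columns are variable nodes (code bits), rows are
check nodes. -/

/-- The variable nodes attached to the check node `a`. -/
def checkNbrs {m n : ℕ} (H : Matrix (Fin m) (Fin n) (ZMod 2)) (a : Fin m) : Finset (Fin n) :=
  Finset.univ.filter fun i => H a i ≠ 0

/-- The check nodes attached to the variable node `i`. -/
def varNbrs {m n : ℕ} (H : Matrix (Fin m) (Fin n) (ZMod 2)) (i : Fin n) : Finset (Fin m) :=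
  Finset.univ.filter fun a => H a i ≠ 0

/-- The maximal variable-node degree. -/
def maxVarDegree {m n : ℕ} (H : Matrix (Fin m) (Fin n) (ZMod 2)) : ℕ :=
  Finset.univ.sup fun i => (varNbrs H i).card

/-- The maximal check-node degree. -/
def maxCheckDegree {m n : ℕ} (H : Matrix (Fin m) (Fin n) (ZMod 2)) : ℕ :=
  Finset.univ.sup fun a => (checkNbrs H a).card

/-- The square root of the product of the two maximal degrees. -/
noncomputable def degreeMean {m n : ℕ} (H : Matrix (Fin m) (Fin n) (ZMod 2)) : ℝ :=
  Real.sqrt ((maxVarDegree H : ℝ) * (maxCheckDegree H : ℝ))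

/-- The Tanner graph: the bipartite graph on variable nodes (`Sum.inl`) and check nodes
(`Sum.inr`). -/
def tannerGraph {m n : ℕ} (H : Matrix (Fin m) (Fin n) (ZMod 2)) :
    SimpleGraph (Fin n ⊕ Fin m) where
  Adj u v :=
    match u, v with
    | Sum.inl i, Sum.inr a => H a i ≠ 0
    | Sum.inr a, Sum.inl i => H a i ≠ 0
    | _, _ => False
  symm := ⟨by
    rintro (i | a) (j | b) h
    · exact h
    · exact h
    · exact h
    · exact h⟩
  loopless := ⟨by
    rintro (i | a) h
    · exact h
    · exact h⟩

/-- Graph distance between two code bits: the smallest number of edges on a path of the Tanner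
graph connecting them, `⊤` if there is none. -/
noncomputable def bitDist {m n : ℕ} (H : Matrix (Fin m) (Fin n) (ZMod 2)) (i j : Fin n) : ℕ∞ :=
  (tannerGraph H).edist (Sum.inl i) (Sum.inl j)

/-- The real number `1` or `-1` carried by a spin. -/
def spinVal (s : ℤˣ) : ℝ := ((s : ℤ) : ℝ)

/-- Channel factor of one bit with noise standard deviation `e`, half-log-likelihood ratio `l` and
spin `s`. For `e = 0` (perfectly received bit, infinite half-log-likelihood ratio)
the normalised factor `exp (l * s) / exp l` degenerates to the indicator of `s = 1`. -/
noncomputable def channelFactor (e l : ℝ) (s : ℤˣ) : ℝ :=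
  if e = 0 then (if s = 1 then 1 else 0) else Real.exp (l * spinVal s)

/-- Unnormalised posterior weight of a spin configuration. -/
noncomputable def gibbsWeight {m n : ℕ} (H : Matrix (Fin m) (Fin n) (ZMod 2))
    (eps l : Fin n → ℝ) (σ : Fin n → ℤˣ) : ℝ :=
  (∏ i, channelFactor (eps i) (l i) (σ i)) *
    ∏ a, (1 / 2 : ℝ) * (1 + ∏ i ∈ checkNbrs H a, spinVal (σ i))

/-- The partition function. -/
noncomputable def partitionFn {m n : ℕ} (H : Matrix (Fin m) (Fin n) (ZMod 2))
    (eps l : Fin n → ℝ) : ℝ :=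
  ∑ σ : Fin n → ℤˣ, gibbsWeight H eps l σ

/-- The posterior (Gibbs) average of `f`. -/
noncomputable def gibbsAvg {m n : ℕ} (H : Matrix (Fin m) (Fin n) (ZMod 2))
    (eps l : Fin n → ℝ) (f : (Fin n → ℤˣ) → ℝ) : ℝ :=
  (∑ σ : Fin n → ℤˣ, f σ * gibbsWeight H eps l σ) / partitionFn H eps l

/-- The posterior correlation of the bits `i` and `j` for the channel realisation `l`. -/
noncomputable def posteriorCov {m n : ℕ} (H : Matrix (Fin m) (Fin n) (ZMod 2))
    (eps l : Fin n → ℝ) (i j : Fin n) : ℝ :=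
  gibbsAvg H eps l (fun σ => spinVal (σ i) * spinVal (σ j)) -
    gibbsAvg H eps l (fun σ => spinVal (σ i)) * gibbsAvg H eps l (fun σ => spinVal (σ j))

/-- Law of the half-log-likelihood ratio of a bit with noise standard deviation `e`, when the
all-zero codeword is sent: Gaussian with mean and variance `1 / e ^ 2`. (For `e = 0` the value
is irrelevant, since `channelFactor` does not depend on it.) -/
noncomputable def llrLaw (e : ℝ) : Measure ℝ :=
  gaussianReal ((e ^ 2)⁻¹) (Real.toNNReal ((e ^ 2)⁻¹))

/-- The joint law of the independent half-log-likelihood ratios of all bits. -/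
noncomputable def noiseLaw {n : ℕ} (eps : Fin n → ℝ) : Measure (Fin n → ℝ) :=
  Measure.pi fun i => llrLaw (eps i)

/-- The noise-averaged absolute posterior correlation between the bits `i` and `j`, where bit `v`
is transmitted with noise variance `eps v ^ 2`. -/
noncomputable def avgCorr {m n : ℕ} (H : Matrix (Fin m) (Fin n) (ZMod 2))
    (eps : Fin n → ℝ) (i j : Fin n) : ℝ :=
  ∫ l, |posteriorCov H eps l i j| ∂(noiseLaw eps)

/-- `exp (-(r * d))` for `r > 0`, with value `0` at `d = ∞`. -/
noncomputable def expNegDist (r : ℝ) (d : ℕ∞) : ℝ :=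
  if d = ⊤ then 0 else Real.exp (-(r * (d.toNat : ℝ)))

/-- `exp (-c / e ^ 2)` for `c > 0`, with value `0` at `e = 0`. -/
noncomputable def expNegInvSq (c e : ℝ) : ℝ :=
  if e = 0 then 0 else Real.exp (-(c / e ^ 2))

end LDPC

/-!
The proof is a Peierls argument on two replicas. Write the posterior covariance of `σ i` and `σ j`
as half the average of `(σ i - τ i) * (σ j - τ j)` over two independent copies `σ`, `τ`, and let
`S` be the connected component of `i` in the union of the supports of the two configurations (the
nodes with `σ v = -1` or `τ v = -1`), two bits being linked when they share a check node. No check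
node sees both `S` and the rest of the union, so exchanging the replicas on `S` preserves the
weight; if `j ∉ S` it changes the sign of the product. Hence only pairs with `j ∈ S` contribute
(`sum_not_mem_cluster`), and the covariance is at most twice the probability that `j ∈ S`.

For the same reason both replicas may be reset to `1` on a given `S`, which is compatible with all
checks and loses only channel factors (`pairWeight_le_reset`). So the probability that the
component is `S` is at most `∏ v ∈ S, (2 * r v + r v ^ 2)`, where `r v = exp (-2 * l v)`. As `r v`
has noise average one, this is useless by itself; but a probability is also at most one, hence at
most the fourth root of that product, whose average is at most
`∏ v ∈ S, 3 * exp (-3 / (8 * eps v ^ 2))` (`avgCorr_le_sum_animals`).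

It remains to sum over the connected sets `S` containing `i` and `j`. Their generating function at
`1 / (4 * K)`, with `K` the product of the two maximal degrees, is at most one, because in a site
percolation with density `1 / (2 * K)` the events that `S` is the open cluster of `i` are disjoint
(`sum_animals_pow_le_one`). The low-noise condition gives
`3 * exp (-1 / (8 * ε ^ 2)) ≤ 1 / (4 * K)`, and each `S` has at least half as many nodes as the
distance from `i` to `j` (`bitDist_le_two_mul_card`), whence the decay. This yields a decay rate
of order `1 / ε ^ 2`, better than the required `1 / (ε ^ 2 * k)`.
-/

namespace LDPC

variable {m n : ℕ} {H : Matrix (Fin m) (Fin n) (ZMod 2)}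

/-! ### Clusters of variable nodes -/

/-- Two variable nodes are linked when some check node is adjacent to both. A node of positive
degree is linked to itself, which is harmless. -/
def Linked (H : Matrix (Fin m) (Fin n) (ZMod 2)) (u v : Fin n) : Prop :=
  ∃ a, u ∈ checkNbrs H a ∧ v ∈ checkNbrs H a

open Classical in
/-- The connected component of `i` in the set `T` of variable nodes, for the relation `Linked`;
it is empty when `i ∉ T`. -/
noncomputable def cluster (H : Matrix (Fin m) (Fin n) (ZMod 2)) (T : Finset (Fin n))
    (i : Fin n) : Finset (Fin n) :=
  T.filter fun v => i ∈ T ∧ Relation.ReflTransGen (fun u w => w ∈ T ∧ Linked H u w) i v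

/-- No link joins a node of `S` to a node of `T` outside `S`. -/
def ClosedIn (H : Matrix (Fin m) (Fin n) (ZMod 2)) (S T : Finset (Fin n)) : Prop :=
  ∀ u ∈ S, ∀ v ∈ T, Linked H u v → v ∈ S

theorem mem_cluster {T : Finset (Fin n)} {i v : Fin n} : v ∈ cluster H T i ↔
    v ∈ T ∧ i ∈ T ∧ Relation.ReflTransGen (fun u w => w ∈ T ∧ Linked H u w) i v := by
  classical
  simp [cluster]

theorem cluster_subset (T : Finset (Fin n)) (i : Fin n) : cluster H T i ⊆ T :=
  fun _ h => (mem_cluster.1 h).1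

theorem mem_of_mem_cluster {T : Finset (Fin n)} {i v : Fin n} (h : v ∈ cluster H T i) : i ∈ T :=
  (mem_cluster.1 h).2.1

theorem self_mem_cluster {T : Finset (Fin n)} {i : Fin n} (h : i ∈ T) : i ∈ cluster H T i :=
  mem_cluster.2 ⟨h, h, .refl⟩

theorem closedIn_cluster (T : Finset (Fin n)) (i : Fin n) : ClosedIn H (cluster H T i) T := by
  intro u hu v hv huv
  obtain ⟨_, hi, hr⟩ := mem_cluster.1 hu
  exact mem_cluster.2 ⟨hv, hi, hr.tail ⟨hv, huv⟩⟩

/-- The cluster is the smallest closed set containing `i`. -/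
theorem cluster_subset_of_closedIn {S T : Finset (Fin n)} {i : Fin n} (hi : i ∈ S)
    (h : ClosedIn H S T) : cluster H T i ⊆ S := by
  intro v hv
  obtain ⟨-, -, hr⟩ := mem_cluster.1 hv
  clear hv
  induction hr with
  | refl => exact hi
  | tail _ hbc ih => exact h _ ih _ hbc.1 hbc.2

theorem cluster_mono {S T : Finset (Fin n)} (h : S ⊆ T) (i : Fin n) :
    cluster H S i ⊆ cluster H T i := by
  intro v hv
  obtain ⟨hvS, hi, hr⟩ := mem_cluster.1 hv
  exact mem_cluster.2
    ⟨h hvS, h hi, Relation.ReflTransGen.mono (fun _ _ hx => ⟨h hx.1, hx.2⟩) _ _ hr⟩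

theorem cluster_cluster (T : Finset (Fin n)) (i : Fin n) :
    cluster H (cluster H T i) i = cluster H T i := by
  by_cases hi : i ∈ T
  · refine (cluster_subset _ _).antisymm ?_
    refine cluster_subset_of_closedIn (self_mem_cluster (self_mem_cluster hi)) ?_
    intro u hu v hv huv
    have hv' := closedIn_cluster T i u (cluster_subset _ _ hu) v hv huv
    exact closedIn_cluster _ i u hu v hv' huv
  · have h0 : cluster H T i = ∅ :=
      Finset.eq_empty_of_forall_notMem fun v hv => hi (mem_of_mem_cluster hv)
    rw [h0]
    exact Finset.subset_empty.1 (cluster_subset _ _)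

/-- A connected set containing `i` that is closed in a larger set is the cluster of `i` there. -/
theorem eq_cluster {S T : Finset (Fin n)} {i : Fin n} (hi : i ∈ S) (hS : cluster H S i = S)
    (hST : S ⊆ T) (hc : ClosedIn H S T) : S = cluster H T i := by
  refine Finset.Subset.antisymm ?_ (cluster_subset_of_closedIn hi hc)
  calc S = cluster H S i := hS.symm
    _ ⊆ _ := cluster_mono hST i

open Classical in
/-- The lattice animals at `i`: the connected sets of variable nodes containing `i`. -/
noncomputable def animals (H : Matrix (Fin m) (Fin n) (ZMod 2)) (i : Fin n) :
    Finset (Finset (Fin n)) :=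
  Finset.univ.filter fun S => i ∈ S ∧ cluster H S i = S

theorem mem_animals {i : Fin n} {S : Finset (Fin n)} :
    S ∈ animals H i ↔ i ∈ S ∧ cluster H S i = S := by
  simp [animals]

/-! ### Distances inside an animal -/

theorem Linked.bitDist_le {u v : Fin n} (h : Linked H u v) : bitDist H u v ≤ 2 := by
  obtain ⟨a, hu, hv⟩ := h
  have h1 : (tannerGraph H).Adj (Sum.inl u) (Sum.inr a) := (Finset.mem_filter.1 hu).2
  have h2 : (tannerGraph H).Adj (Sum.inr a) (Sum.inl v) := (Finset.mem_filter.1 hv).2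
  calc bitDist H u v ≤ _ := SimpleGraph.edist_triangle (v := Sum.inr a)
    _ = 1 + 1 := by
      rw [SimpleGraph.edist_eq_one_iff_adj.2 h1, SimpleGraph.edist_eq_one_iff_adj.2 h2]
    _ = 2 := one_add_one_eq_two

open Classical in
/-- Each ball around `i` in an animal that does not yet exhaust it is strictly contained in the
next one, so its cardinality grows at least linearly with the radius. -/
theorem card_ball_ge {i j : Fin n} {S : Finset (Fin n)} (hS : S ∈ animals H i) (hj : j ∈ S)
    (t : ℕ) (ht : ((2 * t : ℕ) : ℕ∞) < bitDist H i j) :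
    t + 1 ≤ (S.filter fun v => bitDist H i v ≤ (2 * t : ℕ)).card := by
  obtain ⟨hi, hc⟩ := mem_animals.1 hS
  induction t with
  | zero =>
    refine Finset.card_pos.2 ⟨i, Finset.mem_filter.2 ⟨hi, ?_⟩⟩
    simp [bitDist]
  | succ t ih =>
    have ht' : ((2 * t : ℕ) : ℕ∞) < bitDist H i j :=
      lt_of_le_of_lt (by exact_mod_cast (by omega)) ht
    refine Nat.succ_le_of_lt (lt_of_le_of_lt (ih ht') (Finset.card_lt_card ?_))
    rw [Finset.ssubset_iff_of_subset]
    · by_contra! hcon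
      have hclosed : ClosedIn H (S.filter fun v => bitDist H i v ≤ (2 * t : ℕ)) S := by
        intro u hu v hv huv
        refine hcon v (Finset.mem_filter.2 ⟨hv, ?_⟩)
        calc bitDist H i v ≤ bitDist H i u + bitDist H u v := SimpleGraph.edist_triangle
          _ ≤ (2 * t : ℕ) + 2 := add_le_add (Finset.mem_filter.1 hu).2 huv.bitDist_le
          _ = (2 * (t + 1) : ℕ) := by push_cast; ring
      have h0 : j ∈ S.filter fun v => bitDist H i v ≤ (2 * t : ℕ) := by
        refine cluster_subset_of_closedIn (Finset.mem_filter.2 ⟨hi, by simp [bitDist]⟩) hclosed ?_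
        rwa [hc]
      exact absurd (Finset.mem_filter.1 h0).2 (not_le.2 ht')
    · intro v hv
      obtain ⟨h1, h2⟩ := Finset.mem_filter.1 hv
      exact Finset.mem_filter.2 ⟨h1, h2.trans (by exact_mod_cast (by omega))⟩

theorem bitDist_le_two_mul_card {i j : Fin n} {S : Finset (Fin n)} (hS : S ∈ animals H i)
    (hj : j ∈ S) : bitDist H i j ≤ (2 * S.card : ℕ) := by
  classical
  by_contra! h
  have h1 := card_ball_ge hS hj _ h
  have h2 := Finset.card_le_card (Finset.filter_subset
    (fun v => bitDist H i v ≤ ((2 * S.card : ℕ) : ℕ∞)) S)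
  omega

/-- An animal with at least two nodes forces a check node of degree at least two. -/
theorem two_le_maxVarDegree_mul_maxCheckDegree {i j : Fin n} {S : Finset (Fin n)}
    (hS : S ∈ animals H i) (hj : j ∈ S) (hij : i ≠ j) :
    2 ≤ maxVarDegree H * maxCheckDegree H := by
  obtain ⟨hi, hc⟩ := mem_animals.1 hS
  have hex : ∃ v, v ≠ i ∧ Linked H i v := by
    by_contra! hcon
    have : ClosedIn H {i} S := by
      intro u hu v _ huv
      rw [Finset.mem_singleton] at hu ⊢
      by_contra hv
      exact hcon v hv (hu ▸ huv)
    have hj' := cluster_subset_of_closedIn (Finset.mem_singleton_self i) this (hc.symm ▸ hj)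
    exact hij (Finset.mem_singleton.1 hj').symm
  obtain ⟨v, hv, a, hia, hva⟩ := hex
  have h1 : 1 ≤ maxVarDegree H := by
    have : 1 ≤ (varNbrs H i).card := Finset.card_pos.2
      ⟨a, Finset.mem_filter.2 ⟨Finset.mem_univ _, (Finset.mem_filter.1 hia).2⟩⟩
    exact this.trans (Finset.le_sup (f := fun i => (varNbrs H i).card) (Finset.mem_univ i))
  have h2 : 2 ≤ maxCheckDegree H := by
    have : 2 ≤ (checkNbrs H a).card := Finset.one_lt_card.2 ⟨v, hva, i, hia, hv⟩
    exact this.trans (Finset.le_sup (f := fun a => (checkNbrs H a).card) (Finset.mem_univ a))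
  calc 2 = 1 * 2 := rfl
    _ ≤ _ := Nat.mul_le_mul h1 h2

/-! ### Counting animals -/

open Classical in
/-- The outer boundary of `S`. -/
noncomputable def outerBoundary (H : Matrix (Fin m) (Fin n) (ZMod 2)) (S : Finset (Fin n)) :
    Finset (Fin n) :=
  Finset.univ.filter fun v => v ∉ S ∧ ∃ u ∈ S, Linked H u v

theorem card_outerBoundary_le (S : Finset (Fin n)) :
    (outerBoundary H S).card ≤ (maxVarDegree H * maxCheckDegree H) * S.card := by
  classical
  have hsub : outerBoundary H S ⊆ S.biUnion fun u => (varNbrs H u).biUnion (checkNbrs H) := by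
    intro v hv
    obtain ⟨_, _, u, hu, a, hua, hva⟩ := Finset.mem_filter.1 hv
    exact Finset.mem_biUnion.2 ⟨u, hu, Finset.mem_biUnion.2 ⟨a,
      Finset.mem_filter.2 ⟨Finset.mem_univ _, (Finset.mem_filter.1 hua).2⟩, hva⟩⟩
  have hu : ∀ u ∈ S, ((varNbrs H u).biUnion (checkNbrs H)).card ≤
      maxVarDegree H * maxCheckDegree H := by
    intro u _
    refine (Finset.card_biUnion_le_card_mul _ _ (maxCheckDegree H) fun a _ =>
      Finset.le_sup (f := fun a => (checkNbrs H a).card) (Finset.mem_univ a)).trans ?_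
    exact Nat.mul_le_mul_right _
      (Finset.le_sup (f := fun i => (varNbrs H i).card) (Finset.mem_univ u))
  refine (Finset.card_le_card hsub).trans ((Finset.card_biUnion_le_card_mul _ _ _ hu).trans ?_)
  rw [mul_comm]

/-- In site percolation with density `p`, the left-hand side is the sum over all animals at `i`
of the probability that the open cluster of `i` is that animal. -/
theorem sum_animals_percolation_le_one (i : Fin n) {p : ℝ} (hp0 : 0 ≤ p) (hp1 : p ≤ 1) :
    ∑ S ∈ animals H i, p ^ S.card * (1 - p) ^ (outerBoundary H S).card ≤ 1 := by
  classical
  -- `f S` and `g S` are the weights of an open and of a closed site, conditioned on the sites of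
  -- `S` being open and those of its outer boundary being closed.
  let f : Finset (Fin n) → Fin n → ℝ := fun S v => if v ∈ outerBoundary H S then 0 else p
  let g : Finset (Fin n) → Fin n → ℝ := fun S v => if v ∈ S then 0 else 1 - p
  have hq0 : 0 ≤ 1 - p := by linarith
  have hprod : ∀ S : Finset (Fin n), p ^ S.card * (1 - p) ^ (outerBoundary H S).card =
      ∑ T : Finset (Fin n), (∏ v ∈ T, f S v) * ∏ v ∈ Finset.univ \ T, g S v := by
    intro S
    rw [← Finset.powerset_univ, ← Finset.prod_add]
    have hv : ∀ v, f S v + g S v =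
        (if v ∈ S then p else 1) * (if v ∈ outerBoundary H S then 1 - p else 1) := by
      intro v
      by_cases h1 : v ∈ S
      · have h2 : v ∉ outerBoundary H S := fun h => (Finset.mem_filter.1 h).2.1 h1
        simp [f, g, h1, h2]
      · by_cases h2 : v ∈ outerBoundary H S <;> simp [f, g, h1, h2]
    simp_rw [hv, Finset.prod_mul_distrib, Finset.prod_ite_mem, Finset.univ_inter,
      Finset.prod_const]
  have hterm : ∀ T : Finset (Fin n), ∀ S ∈ animals H i,
      (∏ v ∈ T, f S v) * ∏ v ∈ Finset.univ \ T, g S v ≤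
        if S = cluster H T i then (∏ v ∈ T, p) * ∏ v ∈ Finset.univ \ T, (1 - p) else 0 := by
    intro T S hS
    obtain ⟨hi, hc⟩ := mem_animals.1 hS
    split_ifs with h
    · have hf : ∀ v, 0 ≤ f S v ∧ f S v ≤ p := fun v => by
        dsimp only [f]; split_ifs <;> simp [hp0]
      have hg : ∀ v, 0 ≤ g S v ∧ g S v ≤ 1 - p := fun v => by
        dsimp only [g]; split_ifs <;> simp [hp1]
      exact mul_le_mul (Finset.prod_le_prod (fun v _ => (hf v).1) fun v _ => (hf v).2)
        (Finset.prod_le_prod (fun v _ => (hg v).1) fun v _ => (hg v).2)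
        (Finset.prod_nonneg fun v _ => (hg v).1) (Finset.prod_nonneg fun _ _ => hp0)
    · refine le_of_eq ?_
      by_contra hne
      obtain ⟨h1, h2⟩ := mul_ne_zero_iff.1 hne
      rw [Finset.prod_ne_zero_iff] at h1 h2
      refine h (eq_cluster hi hc ?_ ?_)
      · intro v hv
        by_contra hvT
        exact h2 v (by simp [hvT]) (by simp [g, hv])
      · intro u hu v hv huv
        by_contra hvS
        exact h1 v hv (if_pos (Finset.mem_filter.2 ⟨Finset.mem_univ _, hvS, u, hu, huv⟩))
  have hnn : ∀ T : Finset (Fin n),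
      0 ≤ (∏ v ∈ T, p) * ∏ v ∈ Finset.univ \ T, (1 - p) := fun T =>
    mul_nonneg (Finset.prod_nonneg fun _ _ => hp0) (Finset.prod_nonneg fun _ _ => hq0)
  calc ∑ S ∈ animals H i, p ^ S.card * (1 - p) ^ (outerBoundary H S).card
      = ∑ T : Finset (Fin n), ∑ S ∈ animals H i,
          (∏ v ∈ T, f S v) * ∏ v ∈ Finset.univ \ T, g S v := by
        rw [Finset.sum_comm]; exact Finset.sum_congr rfl fun S _ => hprod S
    _ ≤ ∑ T : Finset (Fin n), (∏ v ∈ T, p) * ∏ v ∈ Finset.univ \ T, (1 - p) := by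
        refine Finset.sum_le_sum fun T _ => (Finset.sum_le_sum (hterm T)).trans ?_
        rw [Finset.sum_ite_eq']
        split_ifs
        · exact le_rfl
        · exact hnn T
    _ = 1 := by
        rw [← Finset.powerset_univ, ← Finset.prod_add]
        simp

/-- The generating function of the animals at `i` is at most `1` at `1 / (4 K)`, where `K` bounds
the number of links at a node. -/
theorem sum_animals_pow_le_one (i : Fin n) {K : ℕ} (hK : 1 ≤ K)
    (hd : maxVarDegree H * maxCheckDegree H ≤ K) :
    ∑ S ∈ animals H i, (1 / (4 * K : ℝ)) ^ S.card ≤ 1 := by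
  have hK' : (1 : ℝ) ≤ K := by exact_mod_cast hK
  set p : ℝ := 1 / (2 * K) with hp
  have hp0 : 0 ≤ p := by positivity
  have hp1 : p ≤ 1 / 2 := by
    rw [hp]; exact one_div_le_one_div_of_le (by norm_num) (by linarith)
  have hKp : K * p = 1 / 2 := by rw [hp]; field_simp
  have hbern : 1 / 2 ≤ (1 - p) ^ K := by
    have := one_add_mul_le_pow (a := -p) (by linarith) K
    rw [← sub_eq_add_neg] at this
    linarith
  refine (Finset.sum_le_sum fun S _ => ?_).trans
    (sum_animals_percolation_le_one (H := H) i hp0 (by linarith))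
  calc (1 / (4 * K : ℝ)) ^ S.card = (p * (1 / 2)) ^ S.card := by
        congr 1; rw [hp]; field_simp; norm_num
    _ ≤ (p * (1 - p) ^ K) ^ S.card := by gcongr
    _ = p ^ S.card * (1 - p) ^ (K * S.card) := by rw [mul_pow, pow_mul]
    _ ≤ _ := by
        gcongr ?_ * ?_
        exact pow_le_pow_of_le_one (by linarith) (by linarith)
          ((card_outerBoundary_le S).trans (Nat.mul_le_mul_right _ hd))

end LDPC

namespace LDPC

variable {m n : ℕ} {H : Matrix (Fin m) (Fin n) (ZMod 2)} {eps l : Fin n → ℝ}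

/-! ### Two replicas -/

/-- The Gibbs factor of a check node. -/
noncomputable def checkFactor (H : Matrix (Fin m) (Fin n) (ZMod 2)) (a : Fin m)
    (σ : Fin n → ℤˣ) : ℝ :=
  (1 / 2 : ℝ) * (1 + ∏ i ∈ checkNbrs H a, spinVal (σ i))

/-- A pair of spin configurations is encoded as one configuration with values in `ℤˣ × ℤˣ`;
this is its weight under the square of the Gibbs weight. -/
noncomputable def pairWeight (H : Matrix (Fin m) (Fin n) (ZMod 2)) (eps l : Fin n → ℝ)
    (ω : Fin n → ℤˣ × ℤˣ) : ℝ :=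
  gibbsWeight H eps l (fun v => (ω v).1) * gibbsWeight H eps l (fun v => (ω v).2)

/-- The union of the supports of the two codewords of a pair: the nodes where at least one of
the two spins is `-1`. -/
def pairSupp (ω : Fin n → ℤˣ × ℤˣ) : Finset (Fin n) :=
  Finset.univ.filter fun v => ω v ≠ 1

theorem mem_pairSupp {ω : Fin n → ℤˣ × ℤˣ} {v : Fin n} : v ∈ pairSupp ω ↔ ω v ≠ 1 := by
  simp [pairSupp]

/-- Exchange the two replicas on `S`. -/
def exchange (S : Finset (Fin n)) (ω : Fin n → ℤˣ × ℤˣ) : Fin n → ℤˣ × ℤˣ :=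
  fun v => if v ∈ S then (ω v).swap else ω v

/-- Reset both replicas to `1` on `S`. -/
def reset (S : Finset (Fin n)) (ω : Fin n → ℤˣ × ℤˣ) : Fin n → ℤˣ × ℤˣ :=
  fun v => if v ∈ S then 1 else ω v

@[simp] theorem spinVal_one : spinVal 1 = 1 := by simp [spinVal]

@[simp] theorem spinVal_neg_one : spinVal (-1) = -1 := by simp [spinVal]

theorem spinVal_eq (s : ℤˣ) : spinVal s = 1 ∨ spinVal s = -1 := by
  rcases Int.units_eq_one_or s with rfl | rfl <;> simp

theorem channelFactor_nonneg (e x : ℝ) (s : ℤˣ) : 0 ≤ channelFactor e x s := by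
  unfold channelFactor
  split_ifs <;> positivity

theorem prod_spinVal_eq (s : Finset (Fin n)) (σ : Fin n → ℤˣ) :
    ∏ i ∈ s, spinVal (σ i) = 1 ∨ ∏ i ∈ s, spinVal (σ i) = -1 := by
  have h : ∏ i ∈ s, spinVal (σ i) = spinVal (∏ i ∈ s, σ i) := by
    simp [spinVal, Units.coe_prod]
  rw [h]
  exact spinVal_eq _

theorem checkFactor_nonneg (a : Fin m) (σ : Fin n → ℤˣ) : 0 ≤ checkFactor H a σ := by
  unfold checkFactor
  rcases prod_spinVal_eq (checkNbrs H a) σ with h | h <;> rw [h] <;> norm_num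

theorem checkFactor_le_one (a : Fin m) (σ : Fin n → ℤˣ) : checkFactor H a σ ≤ 1 := by
  unfold checkFactor
  rcases prod_spinVal_eq (checkNbrs H a) σ with h | h <;> rw [h] <;> norm_num

theorem checkFactor_eq_one {a : Fin m} {σ : Fin n → ℤˣ} (h : ∀ v ∈ checkNbrs H a, σ v = 1) :
    checkFactor H a σ = 1 := by
  have : ∏ i ∈ checkNbrs H a, spinVal (σ i) = 1 :=
    Finset.prod_eq_one fun i hi => by rw [h i hi, spinVal_one]
  rw [checkFactor, this]
  norm_num

theorem checkFactor_congr {a : Fin m} {σ τ : Fin n → ℤˣ} (h : ∀ v ∈ checkNbrs H a, σ v = τ v) :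
    checkFactor H a σ = checkFactor H a τ := by
  rw [checkFactor, checkFactor, Finset.prod_congr rfl fun i hi => by rw [h i hi]]

theorem gibbsWeight_nonneg (σ : Fin n → ℤˣ) : 0 ≤ gibbsWeight H eps l σ :=
  mul_nonneg (Finset.prod_nonneg fun _ _ => channelFactor_nonneg _ _ _)
    (Finset.prod_nonneg fun a _ => checkFactor_nonneg a σ)

theorem partitionFn_pos : 0 < partitionFn H eps l := by
  refine Finset.sum_pos' (fun σ _ => gibbsWeight_nonneg σ) ⟨fun _ => 1, Finset.mem_univ _, ?_⟩
  refine mul_pos (Finset.prod_pos fun v _ => ?_) (Finset.prod_pos fun a _ => ?_)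
  · unfold channelFactor
    split_ifs
    · exact one_pos
    · exact absurd rfl ‹_›
    · exact Real.exp_pos _
  · simp

theorem pairWeight_nonneg (ω : Fin n → ℤˣ × ℤˣ) : 0 ≤ pairWeight H eps l ω :=
  mul_nonneg (gibbsWeight_nonneg _) (gibbsWeight_nonneg _)

theorem pairWeight_eq (ω : Fin n → ℤˣ × ℤˣ) : pairWeight H eps l ω =
    (∏ v, channelFactor (eps v) (l v) (ω v).1 * channelFactor (eps v) (l v) (ω v).2) *
      ∏ a, checkFactor H a (fun v => (ω v).1) * checkFactor H a (fun v => (ω v).2) := by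
  rw [Finset.prod_mul_distrib, Finset.prod_mul_distrib]
  unfold pairWeight gibbsWeight checkFactor
  ring

/-- If `S` is closed in the support of the pair, a check node either does not meet `S`, or meets
the support only inside `S`. -/
theorem ClosedIn.check_cases {S : Finset (Fin n)} {ω : Fin n → ℤˣ × ℤˣ}
    (h : ClosedIn H S (pairSupp ω)) (a : Fin m) :
    (∀ v ∈ checkNbrs H a, v ∉ S) ∨ ∀ v ∈ checkNbrs H a, v ∉ S → ω v = 1 := by
  by_contra! hcon
  obtain ⟨⟨u, hu, huS⟩, v, hv, hvS, hv1⟩ := hcon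
  exact hvS (h u huS v (mem_pairSupp.2 hv1) ⟨a, hu, hv⟩)

theorem pairWeight_exchange {S : Finset (Fin n)} {ω : Fin n → ℤˣ × ℤˣ}
    (h : ClosedIn H S (pairSupp ω)) :
    pairWeight H eps l (exchange S ω) = pairWeight H eps l ω := by
  rw [pairWeight_eq, pairWeight_eq]
  congr 1
  · refine Finset.prod_congr rfl fun v _ => ?_
    by_cases hv : v ∈ S
    · simp [exchange, hv, mul_comm]
    · simp [exchange, hv]
  · refine Finset.prod_congr rfl fun a _ => ?_
    rcases h.check_cases a with ha | ha
    · congr 1 <;> exact checkFactor_congr fun v hv => by simp [exchange, ha v hv]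
    · rw [mul_comm]
      congr 1 <;> refine checkFactor_congr fun v hv => ?_ <;> by_cases hvS : v ∈ S
      all_goals simp [exchange, hvS]
      all_goals simp [ha v hv hvS]

/-- The factor by which the channel weight of a spin differs from its value at spin `1`. -/
noncomputable def flipCost (e x : ℝ) (s : ℤˣ) : ℝ :=
  if s = 1 then 1 else if e = 0 then 0 else Real.exp (-(2 * x))

theorem flipCost_nonneg (e x : ℝ) (s : ℤˣ) : 0 ≤ flipCost e x s := by
  unfold flipCost
  split_ifs <;> positivity

theorem channelFactor_eq_mul_flipCost (e x : ℝ) (s : ℤˣ) :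
    channelFactor e x s = channelFactor e x 1 * flipCost e x s := by
  rcases Int.units_eq_one_or s with rfl | rfl
  · simp [flipCost]
  · by_cases he : e = 0
    · simp [flipCost, channelFactor, he]
    · simp only [flipCost, channelFactor, he, if_false, spinVal_neg_one, spinVal_one]
      rw [if_neg (by decide), ← Real.exp_add]
      ring_nf

/-- Cost of a pair of spins relative to the pair `(1, 1)`. -/
noncomputable def pairCost (e x : ℝ) (p : ℤˣ × ℤˣ) : ℝ :=
  flipCost e x p.1 * flipCost e x p.2

theorem pairCost_nonneg (e x : ℝ) (p : ℤˣ × ℤˣ) : 0 ≤ pairCost e x p :=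
  mul_nonneg (flipCost_nonneg _ _ _) (flipCost_nonneg _ _ _)

/-- Peierls bound: resetting a closed set to the all-zero codeword multiplies the weight by at
least the inverse of the channel costs on that set. -/
theorem pairWeight_le_reset {S : Finset (Fin n)} {ω : Fin n → ℤˣ × ℤˣ}
    (h : ClosedIn H S (pairSupp ω)) :
    pairWeight H eps l ω ≤
      pairWeight H eps l (reset S ω) * ∏ v ∈ S, pairCost (eps v) (l v) (ω v) := by
  rw [pairWeight_eq, pairWeight_eq, mul_right_comm]
  have hch : (∏ v, channelFactor (eps v) (l v) (ω v).1 * channelFactor (eps v) (l v) (ω v).2) =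
      (∏ v, channelFactor (eps v) (l v) (reset S ω v).1 *
        channelFactor (eps v) (l v) (reset S ω v).2) *
          ∏ v ∈ S, pairCost (eps v) (l v) (ω v) := by
    rw [← Finset.univ_inter S, ← Finset.prod_ite_mem, ← Finset.prod_mul_distrib]
    refine Finset.prod_congr rfl fun v _ => ?_
    by_cases hv : v ∈ S
    · simp only [reset, hv, if_true, Finset.univ_inter, pairCost, Prod.fst_one, Prod.snd_one]
      rw [channelFactor_eq_mul_flipCost _ _ (ω v).1, channelFactor_eq_mul_flipCost _ _ (ω v).2]
      ring
    · simp [reset, hv]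
  rw [← hch]
  refine mul_le_mul_of_nonneg_left (Finset.prod_le_prod (fun a _ =>
    mul_nonneg (checkFactor_nonneg _ _) (checkFactor_nonneg _ _)) fun a _ => ?_)
    (Finset.prod_nonneg fun v _ =>
      mul_nonneg (channelFactor_nonneg _ _ _) (channelFactor_nonneg _ _ _))
  rcases h.check_cases a with ha | ha
  · refine le_of_eq ?_
    congr 1 <;> exact checkFactor_congr fun v hv => by simp [reset, ha v hv]
  · have h1 : ∀ v ∈ checkNbrs H a, reset S ω v = 1 := fun v hv => by
      by_cases hvS : v ∈ S
      · simp [reset, hvS]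
      · simp [reset, hvS, ha v hv hvS]
    rw [checkFactor_eq_one (σ := fun v => (reset S ω v).1) fun v hv => by rw [h1 v hv]; rfl,
      checkFactor_eq_one (σ := fun v => (reset S ω v).2) fun v hv => by rw [h1 v hv]; rfl]
    exact mul_le_mul (checkFactor_le_one _ _) (checkFactor_le_one _ _)
      (checkFactor_nonneg _ _) zero_le_one

theorem sum_pair_mul (f g : (Fin n → ℤˣ) → ℝ) :
    ∑ ω : Fin n → ℤˣ × ℤˣ, f (fun v => (ω v).1) * g (fun v => (ω v).2) =
      (∑ σ, f σ) * ∑ τ, g τ := by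
  rw [Finset.sum_mul_sum, ← Fintype.sum_prod_type']
  exact Fintype.sum_equiv (Equiv.arrowProdEquivProdArrow _ _ _) _ _ fun ω => rfl

theorem sum_pairWeight : ∑ ω, pairWeight H eps l ω = partitionFn H eps l ^ 2 := by
  rw [sq]
  exact sum_pair_mul _ _

/-- Total weight of the pairs whose supports have `S` as the cluster of `i`. -/
noncomputable def clusterWeight (H : Matrix (Fin m) (Fin n) (ZMod 2)) (eps l : Fin n → ℝ)
    (i : Fin n) (S : Finset (Fin n)) : ℝ :=
  ∑ ω : Fin n → ℤˣ × ℤˣ with cluster H (pairSupp ω) i = S, pairWeight H eps l ω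

theorem clusterWeight_le_sq (i : Fin n) (S : Finset (Fin n)) :
    clusterWeight H eps l i S ≤ partitionFn H eps l ^ 2 := by
  rw [← sum_pairWeight]
  exact Finset.sum_le_sum_of_subset_of_nonneg (Finset.filter_subset _ _)
    fun ω _ _ => pairWeight_nonneg ω

theorem sum_pairCost (e x : ℝ) :
    ∑ p ∈ Finset.univ.erase (1 : ℤˣ × ℤˣ), pairCost e x p =
      2 * flipCost e x (-1) + flipCost e x (-1) ^ 2 := by
  have h : Finset.univ.erase (1 : ℤˣ × ℤˣ) = {(1, -1), (-1, 1), (-1, -1)} := by decide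
  rw [h, Finset.sum_insert (by decide), Finset.sum_insert (by decide), Finset.sum_singleton]
  have h1 : flipCost e x 1 = 1 := by simp [flipCost]
  simp only [pairCost, h1]
  ring

theorem clusterWeight_le_prod (i : Fin n) (S : Finset (Fin n)) :
    clusterWeight H eps l i S ≤ partitionFn H eps l ^ 2 *
      ∏ v ∈ S, (2 * flipCost (eps v) (l v) (-1) + flipCost (eps v) (l v) (-1) ^ 2) := by
  classical
  let F : Finset (Fin n → ℤˣ × ℤˣ) := Finset.univ.filter fun ω => cluster H (pairSupp ω) i = S
  -- A pair is determined by its reset on `S` and by its restriction to `S`, extended by `1`.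
  let restr : (Fin n → ℤˣ × ℤˣ) → Fin n → ℤˣ × ℤˣ := fun ω v => if v ∈ S then ω v else 1
  let Φ : (Fin n → ℤˣ × ℤˣ) → (Fin n → ℤˣ × ℤˣ) × (Fin n → ℤˣ × ℤˣ) :=
    fun ω => (reset S ω, restr ω)
  let t : Fin n → Finset (ℤˣ × ℤˣ) := fun v => if v ∈ S then Finset.univ.erase 1 else {1}
  let G : (Fin n → ℤˣ × ℤˣ) × (Fin n → ℤˣ × ℤˣ) → ℝ := fun q =>
    pairWeight H eps l q.1 * ∏ v, pairCost (eps v) (l v) (q.2 v)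
  have hG : ∀ q, 0 ≤ G q := fun q =>
    mul_nonneg (pairWeight_nonneg _) (Finset.prod_nonneg fun _ _ => pairCost_nonneg _ _ _)
  have hone : ∀ v, pairCost (eps v) (l v) 1 = 1 := fun v => by simp [pairCost, flipCost]
  have hinj : Function.Injective Φ := by
    intro ω ω' hω
    funext v
    have h1 := congrFun (congrArg Prod.fst hω) v
    have h2 := congrFun (congrArg Prod.snd hω) v
    by_cases hv : v ∈ S
    · simpa [Φ, restr, hv] using h2
    · simpa [Φ, reset, hv] using h1
  calc clusterWeight H eps l i S = ∑ ω ∈ F, pairWeight H eps l ω := by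
        unfold clusterWeight; congr!
    _ ≤ ∑ ω ∈ F, G (Φ ω) := by
        refine Finset.sum_le_sum fun ω hω => ?_
        have hc : cluster H (pairSupp ω) i = S := (Finset.mem_filter.1 hω).2
        refine (pairWeight_le_reset (hc ▸ closedIn_cluster (pairSupp ω) i)).trans (le_of_eq ?_)
        dsimp only [G, Φ]
        rw [← Finset.univ_inter S, ← Finset.prod_ite_mem]
        simp only [Finset.univ_inter]
        congr 1
        refine Finset.prod_congr rfl fun v _ => ?_
        by_cases hv : v ∈ S <;> simp [restr, hv, hone]
    _ = ∑ q ∈ F.image Φ, G q := (Finset.sum_image hinj.injOn).symm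
    _ ≤ ∑ q ∈ Finset.univ ×ˢ Fintype.piFinset t, G q := by
        refine Finset.sum_le_sum_of_subset_of_nonneg ?_ fun q _ _ => hG q
        intro q hq
        obtain ⟨ω, hω, rfl⟩ := Finset.mem_image.1 hq
        have hc : cluster H (pairSupp ω) i = S := (Finset.mem_filter.1 hω).2
        refine Finset.mem_product.2 ⟨Finset.mem_univ _, Fintype.mem_piFinset.2 fun v => ?_⟩
        by_cases hv : v ∈ S
        · have : ω v ≠ 1 := mem_pairSupp.1 (cluster_subset _ _ (hc.symm ▸ hv))
          simpa [Φ, restr, t, hv] using this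
        · simp [Φ, restr, t, hv]
    _ = (∑ ω, pairWeight H eps l ω) * ∑ p ∈ Fintype.piFinset t,
          ∏ v, pairCost (eps v) (l v) (p v) := by
        rw [Finset.sum_product, Finset.sum_mul_sum]
    _ = _ := by
        rw [sum_pairWeight, ← Finset.prod_univ_sum]
        congr 1
        rw [← Finset.univ_inter S, ← Finset.prod_ite_mem]
        refine Finset.prod_congr rfl fun v _ => ?_
        by_cases hv : v ∈ S
        · simp only [t, hv, if_true, sum_pairCost]
        · simp [t, hv, hone]

/-! ### The correlation and the cluster of a replica pair -/

theorem posteriorCov_eq (i j : Fin n) :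
    2 * partitionFn H eps l ^ 2 * posteriorCov H eps l i j =
      ∑ ω : Fin n → ℤˣ × ℤˣ, (spinVal (ω i).1 - spinVal (ω i).2) *
        (spinVal (ω j).1 - spinVal (ω j).2) * pairWeight H eps l ω := by
  have hZ : partitionFn H eps l ≠ 0 := partitionFn_pos.ne'
  let w := gibbsWeight H eps l
  let A : (Fin n → ℤˣ) → ℝ := fun σ => spinVal (σ i) * spinVal (σ j) * w σ
  let B : (Fin n → ℤˣ) → ℝ := fun σ => spinVal (σ i) * w σ
  let C : (Fin n → ℤˣ) → ℝ := fun σ => spinVal (σ j) * w σ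
  have key : ∀ ω : Fin n → ℤˣ × ℤˣ, (spinVal (ω i).1 - spinVal (ω i).2) *
        (spinVal (ω j).1 - spinVal (ω j).2) * pairWeight H eps l ω =
      A (fun v => (ω v).1) * w (fun v => (ω v).2) - B (fun v => (ω v).1) * C (fun v => (ω v).2)
      - C (fun v => (ω v).1) * B (fun v => (ω v).2)
      + w (fun v => (ω v).1) * A (fun v => (ω v).2) := by
    intro ω
    simp only [A, B, C, w, pairWeight]
    ring
  rw [Finset.sum_congr rfl fun ω _ => key ω, Finset.sum_add_distrib, Finset.sum_sub_distrib,
    Finset.sum_sub_distrib, sum_pair_mul A w, sum_pair_mul B C, sum_pair_mul C B,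
    sum_pair_mul w A]
  have hw : ∑ σ, w σ = partitionFn H eps l := rfl
  simp only [posteriorCov, gibbsAvg, hw]
  simp only [A, B, C, w]
  field_simp
  ring

theorem exchange_exchange (S : Finset (Fin n)) (ω : Fin n → ℤˣ × ℤˣ) :
    exchange S (exchange S ω) = ω := by
  funext v
  by_cases hv : v ∈ S <;> simp [exchange, hv]

theorem pairSupp_exchange (S : Finset (Fin n)) (ω : Fin n → ℤˣ × ℤˣ) :
    pairSupp (exchange S ω) = pairSupp ω := by
  ext v
  rw [mem_pairSupp, mem_pairSupp, exchange]
  split_ifs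
  · simp only [ne_eq, Prod.ext_iff, Prod.fst_swap, Prod.snd_swap, Prod.fst_one, Prod.snd_one,
      and_comm]
  · rfl

/-- Only pairs for which `j` lies in the cluster of `i` contribute to the correlation: exchanging
the replicas on the cluster of `i` cancels the others in pairs. -/
theorem sum_not_mem_cluster (i j : Fin n) :
    ∑ ω : Fin n → ℤˣ × ℤˣ with j ∉ cluster H (pairSupp ω) i,
      (spinVal (ω i).1 - spinVal (ω i).2) * (spinVal (ω j).1 - spinVal (ω j).2) *
        pairWeight H eps l ω = 0 := by
  have hex : ∀ ω : Fin n → ℤˣ × ℤˣ, j ∉ cluster H (pairSupp ω) i →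
      (spinVal (exchange (cluster H (pairSupp ω) i) ω i).1 -
        spinVal (exchange (cluster H (pairSupp ω) i) ω i).2) *
      (spinVal (exchange (cluster H (pairSupp ω) i) ω j).1 -
        spinVal (exchange (cluster H (pairSupp ω) i) ω j).2) =
      -((spinVal (ω i).1 - spinVal (ω i).2) * (spinVal (ω j).1 - spinVal (ω j).2)) := by
    intro ω hj
    have hj' : exchange (cluster H (pairSupp ω) i) ω j = ω j := by simp [exchange, hj]
    rw [hj']
    by_cases hi : i ∈ pairSupp ω
    · have hi' : exchange (cluster H (pairSupp ω) i) ω i = (ω i).swap := by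
        simp [exchange, self_mem_cluster hi]
      rw [hi', Prod.fst_swap, Prod.snd_swap]
      ring
    · have h1 : ω i = 1 := by simpa [mem_pairSupp] using hi
      have hi' : exchange (cluster H (pairSupp ω) i) ω i = 1 := by
        rw [exchange, h1]; split_ifs <;> rfl
      rw [hi', h1]
      simp
  refine Finset.sum_involution (fun ω _ => exchange (cluster H (pairSupp ω) i) ω) ?_ ?_ ?_ ?_
  · intro ω hω
    rw [hex ω (Finset.mem_filter.1 hω).2, pairWeight_exchange (closedIn_cluster _ i)]
    ring
  · intro ω hω hne heq
    have h := hex ω (Finset.mem_filter.1 hω).2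
    rw [heq] at h
    exact hne (by rw [self_eq_neg.1 h, zero_mul])
  · intro ω hω
    refine Finset.mem_filter.2 ⟨Finset.mem_univ _, ?_⟩
    rw [pairSupp_exchange]
    exact (Finset.mem_filter.1 hω).2
  · intro ω hω
    rw [pairSupp_exchange, exchange_exchange]

open Classical in
theorem sq_mul_abs_posteriorCov_le (i j : Fin n) :
    partitionFn H eps l ^ 2 * |posteriorCov H eps l i j| ≤
      2 * ∑ S ∈ animals H i with j ∈ S, clusterWeight H eps l i S := by
  have hZ : 0 < partitionFn H eps l := partitionFn_pos
  have h1 : 2 * partitionFn H eps l ^ 2 * |posteriorCov H eps l i j| =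
      |∑ ω : Fin n → ℤˣ × ℤˣ with j ∈ cluster H (pairSupp ω) i,
        (spinVal (ω i).1 - spinVal (ω i).2) * (spinVal (ω j).1 - spinVal (ω j).2) *
          pairWeight H eps l ω| := by
    rw [← abs_of_pos (show 0 < 2 * partitionFn H eps l ^ 2 by positivity), ← abs_mul,
      posteriorCov_eq, ← Finset.sum_filter_add_sum_filter_not Finset.univ
        (fun ω => j ∈ cluster H (pairSupp ω) i), sum_not_mem_cluster, add_zero]
  have hd : ∀ p : ℤˣ × ℤˣ, |spinVal p.1 - spinVal p.2| ≤ 2 := by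
    intro p
    rcases spinVal_eq p.1 with h | h <;> rcases spinVal_eq p.2 with h' | h' <;> rw [h, h'] <;>
      norm_num
  have h2 : ∑ S ∈ animals H i with j ∈ S, clusterWeight H eps l i S =
      ∑ ω : Fin n → ℤˣ × ℤˣ with j ∈ cluster H (pairSupp ω) i, pairWeight H eps l ω := by
    rw [← Finset.sum_fiberwise_of_maps_to (g := fun ω => cluster H (pairSupp ω) i)
      (t := (animals H i).filter fun S => j ∈ S)]
    · refine Finset.sum_congr rfl fun S hS => ?_
      rw [clusterWeight, Finset.filter_filter]
      refine Finset.sum_congr ?_ fun _ _ => rfl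
      ext ω
      simp only [Finset.mem_filter, Finset.mem_univ, true_and]
      exact ⟨fun h => ⟨h ▸ (Finset.mem_filter.1 hS).2, h⟩, fun h => h.2⟩
    · intro ω hω
      have hj := (Finset.mem_filter.1 hω).2
      exact Finset.mem_filter.2 ⟨mem_animals.2
        ⟨self_mem_cluster (mem_of_mem_cluster hj), cluster_cluster _ _⟩, hj⟩
  have h3 : 2 * partitionFn H eps l ^ 2 * |posteriorCov H eps l i j| ≤
      4 * ∑ S ∈ animals H i with j ∈ S, clusterWeight H eps l i S := by
    rw [h1, h2, Finset.mul_sum]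
    refine (Finset.abs_sum_le_sum_abs _ _).trans (Finset.sum_le_sum fun ω _ => ?_)
    rw [abs_mul, abs_mul, abs_of_nonneg (pairWeight_nonneg ω)]
    refine mul_le_mul_of_nonneg_right ?_ (pairWeight_nonneg ω)
    nlinarith [hd (ω i), hd (ω j), abs_nonneg (spinVal (ω i).1 - spinVal (ω i).2),
      abs_nonneg (spinVal (ω j).1 - spinVal (ω j).2)]
  linarith

/-- An upper bound for the fourth root of `2 r + r ^ 2`, where `r` is the flip cost. The root
makes the average over the noise exponentially small: `r` itself has average one. -/
noncomputable def rootCost (e x : ℝ) : ℝ :=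
  if e = 0 then 0 else 2 * Real.exp (-1 / 2 * x) + Real.exp (-1 * x)

theorem rootCost_nonneg (e x : ℝ) : 0 ≤ rootCost e x := by
  unfold rootCost
  split_ifs <;> positivity

theorem flipCost_le_rootCost_pow (e x : ℝ) :
    2 * flipCost e x (-1) + flipCost e x (-1) ^ 2 ≤ rootCost e x ^ 4 := by
  have h : ((-1 : ℤˣ) = 1) = False := by decide
  simp only [flipCost, rootCost, h, if_false]
  split_ifs with he
  · simp
  · set q := Real.exp (-1 / 2 * x) with hq
    have hq0 : 0 < q := Real.exp_pos _
    have h1 : Real.exp (-1 * x) = q ^ 2 := by rw [hq, ← Real.exp_nat_mul]; push_cast; ring_nf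
    have h2 : Real.exp (-(2 * x)) = q ^ 4 := by rw [hq, ← Real.exp_nat_mul]; push_cast; ring_nf
    rw [h1, h2]
    have : (2 * q + q ^ 2) ^ 4 - (2 * q ^ 4 + (q ^ 4) ^ 2) =
      14 * q ^ 4 + 32 * q ^ 5 + 24 * q ^ 6 + 8 * q ^ 7 := by ring
    have : 0 ≤ 14 * q ^ 4 + 32 * q ^ 5 + 24 * q ^ 6 + 8 * q ^ 7 := by positivity
    linarith

open Classical in
theorem abs_posteriorCov_le (i j : Fin n) :
    |posteriorCov H eps l i j| ≤
      2 * ∑ S ∈ animals H i with j ∈ S, ∏ v ∈ S, rootCost (eps v) (l v) := by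
  have hZ : 0 < partitionFn H eps l ^ 2 := pow_pos partitionFn_pos 2
  refine le_of_mul_le_mul_left ((sq_mul_abs_posteriorCov_le i j).trans ?_) hZ
  rw [mul_left_comm, Finset.mul_sum (a := partitionFn H eps l ^ 2)]
  refine mul_le_mul_of_nonneg_left (Finset.sum_le_sum fun S _ => ?_) zero_le_two
  have hP : 0 ≤ ∏ v ∈ S, rootCost (eps v) (l v) :=
    Finset.prod_nonneg fun _ _ => rootCost_nonneg _ _
  -- A probability bounded by the fourth power of `P` is bounded by `P`.
  rcases le_total 1 (∏ v ∈ S, rootCost (eps v) (l v)) with h | h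
  · exact (clusterWeight_le_sq i S).trans (le_mul_of_one_le_right hZ.le h)
  · have hf : ∀ v, 0 ≤ flipCost (eps v) (l v) (-1) := fun v => flipCost_nonneg _ _ _
    have h0 : ∀ v, 0 ≤ 2 * flipCost (eps v) (l v) (-1) + flipCost (eps v) (l v) (-1) ^ 2 :=
      fun v => add_nonneg (mul_nonneg zero_le_two (hf v)) (sq_nonneg _)
    refine (clusterWeight_le_prod i S).trans (mul_le_mul_of_nonneg_left ?_ hZ.le)
    calc ∏ v ∈ S, (2 * flipCost (eps v) (l v) (-1) + flipCost (eps v) (l v) (-1) ^ 2)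
        ≤ ∏ v ∈ S, rootCost (eps v) (l v) ^ 4 :=
          Finset.prod_le_prod (fun v _ => h0 v) fun v _ => flipCost_le_rootCost_pow _ _
      _ = (∏ v ∈ S, rootCost (eps v) (l v)) ^ 4 := Finset.prod_pow _ _ _
      _ ≤ _ := pow_le_of_le_one hP h (by norm_num)

end LDPC

namespace LDPC

variable {m n : ℕ} {H : Matrix (Fin m) (Fin n) (ZMod 2)} {eps : Fin n → ℝ}

/-! ### Averaging over the noise -/

instance isProbabilityMeasure_llrLaw (e : ℝ) : IsProbabilityMeasure (llrLaw e) := by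
  unfold llrLaw
  infer_instance

theorem integrable_exp_llrLaw (e t : ℝ) : Integrable (fun x => Real.exp (t * x)) (llrLaw e) :=
  integrable_exp_mul_gaussianReal t

theorem integral_exp_llrLaw (e t : ℝ) :
    ∫ x, Real.exp (t * x) ∂llrLaw e = Real.exp ((t + t ^ 2 / 2) / e ^ 2) := by
  have h := mgf_gaussianReal (p := llrLaw e) (X := id) (μ := (e ^ 2)⁻¹)
    (v := Real.toNNReal ((e ^ 2)⁻¹)) (by rw [Measure.map_id]; rfl) t
  rw [Real.coe_toNNReal _ (by positivity)] at h
  simp only [mgf, id] at h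
  rw [h]
  congr 1
  ring

theorem integrable_rootCost (e : ℝ) : Integrable (rootCost e) (llrLaw e) := by
  unfold rootCost
  by_cases he : e = 0
  · simp [he]
  · simp only [he, if_false]
    exact ((integrable_exp_llrLaw e _).const_mul 2).add (integrable_exp_llrLaw e _)

theorem integral_rootCost_le (e : ℝ) :
    ∫ x, rootCost e x ∂llrLaw e ≤ 3 * expNegInvSq (3 / 8) e := by
  unfold rootCost expNegInvSq
  by_cases he : e = 0
  · simp [he]
  · simp only [he, if_false]
    rw [integral_add ((integrable_exp_llrLaw e _).const_mul 2) (integrable_exp_llrLaw e _),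
      integral_const_mul, integral_exp_llrLaw, integral_exp_llrLaw]
    have h1 : (-1 / 2 + (-1 / 2) ^ 2 / 2) / e ^ 2 = -(3 / 8 / e ^ 2) := by ring
    have h2 : Real.exp ((-1 + (-1) ^ 2 / 2) / e ^ 2) ≤ Real.exp (-(3 / 8 / e ^ 2)) := by
      rw [Real.exp_le_exp, ← neg_div]
      exact div_le_div_of_nonneg_right (by norm_num) (by positivity)
    rw [h1]
    linarith

theorem expNegInvSq_nonneg (c e : ℝ) : 0 ≤ expNegInvSq c e := by
  unfold expNegInvSq
  split_ifs <;> positivity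

theorem integral_prod_rootCost (S : Finset (Fin n)) :
    Integrable (fun l => ∏ v ∈ S, rootCost (eps v) (l v)) (noiseLaw eps) ∧
      ∫ l, ∏ v ∈ S, rootCost (eps v) (l v) ∂noiseLaw eps ≤
        ∏ v ∈ S, 3 * expNegInvSq (3 / 8) (eps v) := by
  classical
  let f : Fin n → ℝ → ℝ := fun v => if v ∈ S then rootCost (eps v) else fun _ => 1
  have hf : (fun l : Fin n → ℝ => ∏ v ∈ S, rootCost (eps v) (l v)) =
      fun l => ∏ v, f v (l v) := by
    funext l
    rw [← Finset.univ_inter S, ← Finset.prod_ite_mem]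
    refine Finset.prod_congr rfl fun v _ => ?_
    by_cases hv : v ∈ S <;> simp [f, hv]
  have hint : ∀ v, Integrable (f v) (llrLaw (eps v)) := fun v => by
    by_cases hv : v ∈ S
    · simpa [f, hv] using integrable_rootCost (eps v)
    · simp [f, hv]
  rw [hf]
  refine ⟨Integrable.fintype_prod hint, ?_⟩
  rw [noiseLaw, integral_fintype_prod_eq_prod, ← Finset.univ_inter S, ← Finset.prod_ite_mem]
  refine Finset.prod_le_prod (fun v _ => integral_nonneg fun x => ?_) fun v _ => ?_
  · by_cases hv : v ∈ S
    · simpa [f, hv] using rootCost_nonneg _ _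
    · simp [f, hv]
  · by_cases hv : v ∈ S
    · simpa [f, hv] using integral_rootCost_le (eps v)
    · simp [f, hv]

open Classical in
/-- The averaged correlation is bounded by a sum over the animals joining the two nodes. -/
theorem avgCorr_le_sum_animals (i j : Fin n) :
    avgCorr H eps i j ≤
      2 * ∑ S ∈ animals H i with j ∈ S, ∏ v ∈ S, 3 * expNegInvSq (3 / 8) (eps v) := by
  have hint : ∀ S ∈ (animals H i).filter (fun S => j ∈ S),
      Integrable (fun l => ∏ v ∈ S, rootCost (eps v) (l v)) (noiseLaw eps) :=
    fun S _ => (integral_prod_rootCost S).1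
  calc avgCorr H eps i j
      ≤ ∫ l, 2 * ∑ S ∈ animals H i with j ∈ S, ∏ v ∈ S, rootCost (eps v) (l v)
          ∂noiseLaw eps :=
        integral_mono_of_nonneg (Filter.Eventually.of_forall fun l => abs_nonneg _)
          ((integrable_finsetSum _ hint).const_mul 2)
          (Filter.Eventually.of_forall fun l => abs_posteriorCov_le i j)
    _ = 2 * ∑ S ∈ animals H i with j ∈ S, ∫ l, ∏ v ∈ S, rootCost (eps v) (l v)
          ∂noiseLaw eps := by
        rw [integral_const_mul, integral_finsetSum _ hint]
    _ ≤ _ := mul_le_mul_of_nonneg_left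
        (Finset.sum_le_sum fun S _ => (integral_prod_rootCost S).2) zero_le_two

/-! ### Summing over animals -/

theorem expNegInvSq_add (c d e : ℝ) :
    expNegInvSq (c + d) e = expNegInvSq c e * expNegInvSq d e := by
  unfold expNegInvSq
  split_ifs
  · simp
  · rw [← Real.exp_add]; ring_nf

theorem expNegInvSq_le {c e ε : ℝ} (hc : 0 ≤ c) (he : 0 ≤ e) (h : e ≤ ε) :
    expNegInvSq c e ≤ Real.exp (-(c / ε ^ 2)) := by
  unfold expNegInvSq
  split_ifs with h0
  · positivity
  · have : 0 < e := lt_of_le_of_ne he (Ne.symm h0)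
    rw [Real.exp_le_exp]
    gcongr

theorem expNegInvSq_le_one {c : ℝ} (hc : 0 ≤ c) (e : ℝ) : expNegInvSq c e ≤ 1 := by
  unfold expNegInvSq
  split_ifs
  · exact zero_le_one
  · rw [Real.exp_le_one_iff, neg_nonpos]; positivity

theorem expNegDist_nonneg (r : ℝ) (d : ℕ∞) : 0 ≤ expNegDist r d := by
  unfold expNegDist
  split_ifs <;> positivity

/-- The low-noise condition makes the cost per node small enough to beat the number of animals. -/
theorem three_mul_exp_le {K : ℕ} (hK : 2 ≤ K) {ε : ℝ} (hε : 0 < ε)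
    (h : ε ^ 2 * (Real.sqrt K ^ 2 * Real.log (Real.sqrt K)) ≤ (1 / 8) ^ 2) :
    3 * Real.exp (-(1 / 8 / ε ^ 2)) ≤ 1 / (4 * K : ℝ) := by
  have hK' : (2 : ℝ) ≤ K := by exact_mod_cast hK
  have hlog : 0 ≤ Real.log K := Real.log_nonneg (by linarith)
  rw [Real.sq_sqrt (by positivity), Real.log_sqrt (by positivity)] at h
  have h1 : ε ^ 2 * Real.log K ≤ 1 / 64 := by
    have h0 : 0 ≤ ε ^ 2 * Real.log K := by positivity
    nlinarith
  have h2 : 8 * Real.log K ≤ 1 / 8 / ε ^ 2 := by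
    rw [le_div_iff₀ (by positivity)]
    linarith
  have h3 : (K : ℝ) ^ 8 ≤ Real.exp (1 / 8 / ε ^ 2) := by
    rw [← Real.exp_log (show (0 : ℝ) < K ^ 8 by positivity), Real.log_pow, Real.exp_le_exp]
    exact_mod_cast h2
  have h4 : 12 * (K : ℝ) ≤ K ^ 8 := by
    have : (2 : ℝ) ^ 7 ≤ K ^ 7 := by gcongr
    calc 12 * (K : ℝ) ≤ K ^ 7 * K := by gcongr; linarith
      _ = K ^ 8 := by ring
  rw [Real.exp_neg, le_div_iff₀ (by positivity), ← div_eq_mul_inv, div_mul_eq_mul_div,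
    div_le_one (Real.exp_pos _)]
  linarith

open Classical in
/-- The exponent `3 / 8` of the cost of a node is split into three equal parts: one is kept for
the two end nodes, one yields the decay with the distance, one pays for the number of animals. -/
theorem avgCorr_le {ε : ℝ} (hε : 0 < ε)
    (hlow : ε ^ 2 * (degreeMean H ^ 2 * Real.log (degreeMean H)) ≤ (1 / 8) ^ 2)
    {i j : Fin n} (hij : i ≠ j) (heps : ∀ v, 0 ≤ eps v ∧ eps v ≤ ε) :
    avgCorr H eps i j ≤ 2 * (expNegInvSq (1 / 8) (eps i) * expNegInvSq (1 / 8) (eps j)) *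
      expNegDist (1 / 16 / (ε ^ 2 * degreeMean H)) (bitDist H i j) := by
  refine (avgCorr_le_sum_animals i j).trans ?_
  rw [mul_assoc]
  refine mul_le_mul_of_nonneg_left ?_ zero_le_two
  set K := maxVarDegree H * maxCheckDegree H with hKdef
  have hk : degreeMean H = Real.sqrt K := by rw [degreeMean, hKdef]; push_cast; rfl
  set A := expNegInvSq (1 / 8) (eps i) * expNegInvSq (1 / 8) (eps j) with hA
  set D := expNegDist (1 / 16 / (ε ^ 2 * degreeMean H)) (bitDist H i j) with hD
  have hAD : 0 ≤ A * D := mul_nonneg (mul_nonneg (expNegInvSq_nonneg _ _)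
    (expNegInvSq_nonneg _ _)) (expNegDist_nonneg _ _)
  have hterm : ∀ S ∈ (animals H i).filter (fun S => j ∈ S),
      ∏ v ∈ S, 3 * expNegInvSq (3 / 8) (eps v) ≤ A * D * (1 / (4 * K : ℝ)) ^ S.card := by
    intro S hS
    obtain ⟨hSa, hjS⟩ := Finset.mem_filter.1 hS
    have hiS : i ∈ S := (mem_animals.1 hSa).1
    have hK2 : 2 ≤ K := two_le_maxVarDegree_mul_maxCheckDegree hSa hjS hij
    set x := Real.exp (-(1 / 8 / ε ^ 2)) with hx
    have hv : ∀ v, 3 * expNegInvSq (3 / 8) (eps v) ≤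
        expNegInvSq (1 / 8) (eps v) * (x * (3 * x)) := by
      intro v
      have hsplit : expNegInvSq (3 / 8) (eps v) = expNegInvSq (1 / 8) (eps v) *
          (expNegInvSq (1 / 8) (eps v) * expNegInvSq (1 / 8) (eps v)) := by
        rw [← expNegInvSq_add, ← expNegInvSq_add]; norm_num
      have hle : expNegInvSq (1 / 8) (eps v) ≤ x :=
        expNegInvSq_le (by norm_num) (heps v).1 (heps v).2
      have h0 := expNegInvSq_nonneg (1 / 8) (eps v)
      rw [hsplit]
      calc _ = 3 * (expNegInvSq (1 / 8) (eps v) *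
            (expNegInvSq (1 / 8) (eps v) * expNegInvSq (1 / 8) (eps v))) := rfl
        _ ≤ 3 * (expNegInvSq (1 / 8) (eps v) * (x * x)) := by gcongr
        _ = _ := by ring
    have hends : ∏ v ∈ S, expNegInvSq (1 / 8) (eps v) ≤ A := by
      have hsub : {i, j} ⊆ S := Finset.insert_subset hiS (Finset.singleton_subset_iff.2 hjS)
      rw [← Finset.prod_sdiff hsub, Finset.prod_pair hij]
      exact mul_le_of_le_one_left (mul_nonneg (expNegInvSq_nonneg _ _) (expNegInvSq_nonneg _ _))
        (Finset.prod_le_one (fun v _ => expNegInvSq_nonneg _ _)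
          fun v _ => expNegInvSq_le_one (by norm_num) _)
    have hdist : x ^ S.card ≤ D := by
      have hle := bitDist_le_two_mul_card hSa hjS
      have htop : bitDist H i j ≠ ⊤ := ne_top_of_le_ne_top (ENat.natCast_ne_top _) hle
      have hle' : (bitDist H i j).toNat ≤ 2 * S.card := ENat.toNat_le_of_le_natCast hle
      have hle'' : ((bitDist H i j).toNat : ℝ) ≤ 2 * S.card := by exact_mod_cast hle'
      rw [hD, expNegDist, if_neg htop, hx, ← Real.exp_nat_mul, Real.exp_le_exp, mul_neg,
        neg_le_neg_iff]
      have hk1 : 1 ≤ degreeMean H := by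
        rw [hk, Real.one_le_sqrt]; exact_mod_cast (by omega)
      calc 1 / 16 / (ε ^ 2 * degreeMean H) * ((bitDist H i j).toNat : ℝ)
          ≤ 1 / 16 / ε ^ 2 * (2 * S.card) := by
            gcongr
            exact le_mul_of_one_le_right (by positivity) hk1
        _ = S.card * (1 / 8 / ε ^ 2) := by ring
    have hcount : 3 * x ≤ 1 / (4 * K : ℝ) := three_mul_exp_le hK2 hε (by rw [← hk]; exact hlow)
    have hx0 : 0 ≤ x := (Real.exp_pos _).le
    calc ∏ v ∈ S, 3 * expNegInvSq (3 / 8) (eps v)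
        ≤ ∏ v ∈ S, expNegInvSq (1 / 8) (eps v) * (x * (3 * x)) :=
          Finset.prod_le_prod (fun v _ => mul_nonneg (by norm_num) (expNegInvSq_nonneg _ _))
            fun v _ => hv v
      _ = (∏ v ∈ S, expNegInvSq (1 / 8) (eps v)) * x ^ S.card * (3 * x) ^ S.card := by
          rw [Finset.prod_mul_distrib, Finset.prod_const, mul_pow, mul_assoc]
      _ ≤ A * D * (1 / (4 * K : ℝ)) ^ S.card := by
          have hA0 : 0 ≤ A := mul_nonneg (expNegInvSq_nonneg _ _) (expNegInvSq_nonneg _ _)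
          gcongr
  by_cases hK : 1 ≤ K
  · calc _ ≤ ∑ S ∈ animals H i with j ∈ S, A * D * (1 / (4 * K : ℝ)) ^ S.card :=
          Finset.sum_le_sum hterm
      _ ≤ ∑ S ∈ animals H i, A * D * (1 / (4 * K : ℝ)) ^ S.card :=
          Finset.sum_le_sum_of_subset_of_nonneg (Finset.filter_subset _ _)
            fun S _ _ => by positivity
      _ ≤ A * D := by
          rw [← Finset.mul_sum]
          exact mul_le_of_le_one_right hAD (sum_animals_pow_le_one i hK le_rfl)
  · -- Without links no animal contains two nodes.
    have hempty : (animals H i).filter (fun S => j ∈ S) = ∅ :=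
      Finset.eq_empty_of_forall_notMem fun S hS => hK <| one_le_two.trans
        (two_le_maxVarDegree_mul_maxCheckDegree (Finset.mem_filter.1 hS).1
          (Finset.mem_filter.1 hS).2 hij)
    rw [hempty, Finset.sum_empty]
    exact hAD

end LDPC

theorem theorem1 :
    ∃ ε₀ c₁ c₂ c : ℝ, 0 < ε₀ ∧ 0 < c₁ ∧ 0 < c₂ ∧ 0 < c ∧
      ∀ (m n : ℕ) (H : Matrix (Fin m) (Fin n) (ZMod 2)) (ε : ℝ), 0 < ε →
        ε ^ 2 * (LDPC.degreeMean H ^ 2 * Real.log (LDPC.degreeMean H)) ≤ ε₀ ^ 2 →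
        ∀ i j : Fin n, (4 * LDPC.maxVarDegree H : ℕ) < LDPC.bitDist H i j →
          LDPC.avgCorr H (fun _ => ε) i j ≤
              c₁ * LDPC.expNegDist (c₂ / (ε ^ 2 * LDPC.degreeMean H)) (LDPC.bitDist H i j) ∧
          ∀ eps : Fin n → ℝ, (∀ v, 0 ≤ eps v ∧ eps v ≤ ε) →
            LDPC.avgCorr H eps i j ≤
              c₁ * (LDPC.expNegInvSq c (eps i) * LDPC.expNegInvSq c (eps j)) *
                LDPC.expNegDist (c₂ / (ε ^ 2 * LDPC.degreeMean H)) (LDPC.bitDist H i j) := by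
  refine ⟨1 / 8, 2, 1 / 16, 1 / 8, by norm_num, by norm_num, by norm_num, by norm_num, ?_⟩
  intro m n H ε hε hlow i j hdist
  have hij : i ≠ j := by
    rintro rfl
    simp [LDPC.bitDist] at hdist
  refine ⟨?_, fun eps heps => LDPC.avgCorr_le hε hlow hij heps⟩
  refine (LDPC.avgCorr_le hε hlow hij fun _ => ⟨hε.le, le_rfl⟩).trans ?_
  refine mul_le_mul_of_nonneg_right ?_ (LDPC.expNegDist_nonneg _ _)
  refine mul_le_of_le_one_right zero_le_two ?_
  exact mul_le_one₀ (LDPC.expNegInvSq_le_one (by norm_num) _) (LDPC.expNegInvSq_nonneg _ _)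
    (LDPC.expNegInvSq_le_one (by norm_num) _)
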